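/- Let $k$ be an algebraically closed field and let $C$ be a finite dimensional $k$-algebra of global dimension $2$. All modules are finitely generated right modules, and $D=\operatorname{Hom}_k(-,k)$. Let $E=\operatorname{Ext}^2_C(DC,C)$ with its natural $C$-$C$-bimodule structure (the left action is induced by the left action of $C$ on the second argument $C$, the right action by the left action of $C$ on the first argument $DC$), and let $B=C\ltimes E$ be the relation extension of $C$, that is, the $k$-algebra with underlying space $C\oplus E$ and multiplication $(c,e)(c',e')=(cc',ce'+ec')$. A $C$-module $M$ is regarded as a $B$-module through $m\cdot(c,e)=mc$. For a finite dimensional $k$-algebra $\Lambda$ and a $\Lambda$-module $X$ with minimal projective presentation $P_1\to P_0\to X\to 0$, let $\tau_\Lambda X=D\operatorname{coker}\bigl(\operatorname{Hom}_\Lambda(P_0,\Lambda)\to\operatorname{Hom}_\Lambda(P_1,\Lambda)\bigr)$ be the Auslander-Reiten translate of $X$; the module $X$ is called $\tau_\Lambda$-rigid if $\operatorname{Hom}_\Lambda(X,\tau_\Lambda X)=0$. Let $M$ be a $\tau_C$-rigid $C$-module which is faithful, that is, $\{c\in C \mid Mc=0\}=0$. Then $M$ is $\tau_B$-rigid if and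 only if the injective dimension of $M$ satisfies $\operatorname{id}_C M\le 1$. -/

import Mathlib

open CategoryTheory MulOpposite

universe u

namespace RelExt

/-! Right modules over a ring `Λ` are modules over `Λᵐᵒᵖ`: the element `m · a` is `op a • m`. -/

/-! ## The standard duality `D = Hom_k(-, k)` -/

section Duality

variable (k : Type u) [Field k]

/-- The `k`-linear dual `D N = Hom_k(N, k)`. -/
def StdDual (N : Type u) [AddCommGroup N] [Module k N] : Type u := N →ₗ[k] k

variable (N : Type u) [AddCommGroup N] [Module k N]

noncomputable instance : AddCommGroup (StdDual k N) :=
  inferInstanceAs (AddCommGroup (N →ₗ[k] k))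

noncomputable instance : Module k (StdDual k N) :=
  inferInstanceAs (Module k (N →ₗ[k] k))

instance : FunLike (StdDual k N) N k := inferInstanceAs (FunLike (N →ₗ[k] k) N k)

variable {Λ : Type u} [Ring Λ] [Algebra k Λ] [Module Λ N] [IsScalarTower k Λ N]

/-- Multiplication by `a : Λ` on a left `Λ`-module, as a `k`-linear map. -/
def lmulMap (a : Λ) : N →ₗ[k] N where
  toFun n := a • n
  map_add' := smul_add a
  map_smul' r n := smul_comm a r n

/-- If `N` is a left `Λ`-module then `D N` is a right `Λ`-module through `(f · a)(n) = f (a n)`. -/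
noncomputable instance : Module Λᵐᵒᵖ (StdDual k N) where
  smul a f := LinearMap.comp (show N →ₗ[k] k from f) (lmulMap k N (unop a))
  one_smul f := DFunLike.ext _ _ fun n => congrArg f (one_smul Λ n)
  mul_smul a b f := DFunLike.ext _ _ fun n => congrArg f (mul_smul (unop b) (unop a) n)
  smul_zero _ := rfl
  smul_add _ _ _ := rfl
  add_smul a b f := DFunLike.ext _ _ fun n =>
    (congrArg f (add_smul (unop a) (unop b) n)).trans
      (map_add (show N →ₗ[k] k from f) _ _)
  zero_smul f := DFunLike.ext _ _ fun n =>
    (congrArg f (zero_smul Λ n)).trans (map_zero (show N →ₗ[k] k from f))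

theorem op_smul_apply (a : Λ) (f : StdDual k N) (n : N) : (op a • f) n = f (a • n) := rfl

end Duality

/-! ## The Auslander-Reiten translation -/

section Translation

/-- `f : P → M` is a projective cover of `M` (in finitely generated modules): `P` is finitely
generated projective, and `f` is surjective with superfluous kernel. -/
structure IsProjectiveCover {R : Type u} [Ring R] {P M : Type u} [AddCommGroup P] [Module R P]
    [AddCommGroup M] [Module R M] (f : P →ₗ[R] M) : Prop where
  finite : Module.Finite R P
  projective : Module.Projective R P
  surjective : Function.Surjective f
  superfluous : ∀ N : Submodule R P, N ⊔ LinearMap.ker f = ⊤ → N = ⊤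

/-- A minimal projective presentation `P₁ → P₀ → M → 0` of a right `Λ`-module `M`:
`P₀ → M` is a projective cover, and `P₁ → P₀` is a projective cover of the kernel of `P₀ → M`
followed by the inclusion. -/
structure MinProjPres (Λ : Type u) [Ring Λ] (M : ModuleCat.{u} Λᵐᵒᵖ) where
  P₀ : ModuleCat.{u} Λᵐᵒᵖ
  P₁ : ModuleCat.{u} Λᵐᵒᵖ
  d₀ : P₀ →ₗ[Λᵐᵒᵖ] M
  e₁ : P₁ →ₗ[Λᵐᵒᵖ] LinearMap.ker d₀
  cover₀ : IsProjectiveCover d₀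
  cover₁ : IsProjectiveCover e₁

namespace MinProjPres

variable {Λ : Type u} [Ring Λ] {M : ModuleCat.{u} Λᵐᵒᵖ} (p : MinProjPres Λ M)

/-- The map `P₁ → P₀` of the presentation. -/
def d₁ : p.P₁ →ₗ[Λᵐᵒᵖ] p.P₀ := (LinearMap.ker p.d₀).subtype ∘ₗ p.e₁

/-- The map of left `Λ`-modules `Hom_Λ(P₀, Λ) → Hom_Λ(P₁, Λ)` induced by `P₁ → P₀`. -/
def d₁Star : (p.P₀ →ₗ[Λᵐᵒᵖ] Λ) →ₗ[Λ] (p.P₁ →ₗ[Λᵐᵒᵖ] Λ) where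
  toFun φ := φ ∘ₗ p.d₁
  map_add' _ _ := rfl
  map_smul' _ _ := rfl

/-- The transpose `Tr M`, the left `Λ`-module `coker (Hom_Λ(P₀, Λ) → Hom_Λ(P₁, Λ))`. -/
abbrev Transpose : Type u := (p.P₁ →ₗ[Λᵐᵒᵖ] Λ) ⧸ LinearMap.range p.d₁Star

/-- The Auslander-Reiten translate `τ M = D Tr M`, a right `Λ`-module. -/
noncomputable abbrev tau (k : Type u) [Field k] [Algebra k Λ] : ModuleCat.{u} Λᵐᵒᵖ :=
  ModuleCat.of Λᵐᵒᵖ (StdDual k p.Transpose)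

end MinProjPres

/-- `M` is `τ_Λ`-rigid: `Hom_Λ(M, τ_Λ M) = 0`. A minimal projective presentation of a finitely
generated module over a finite dimensional algebra exists and is unique up to isomorphism, so that
it does not matter which one computes `τ_Λ M`. -/
def IsTauRigid (k : Type u) [Field k] (Λ : Type u) [Ring Λ] [Algebra k Λ]
    (M : ModuleCat.{u} Λᵐᵒᵖ) : Prop :=
  ∃ p : MinProjPres Λ M, ∀ f : M ⟶ p.tau k, f = 0

end Translation

/-- The global dimension of `C`: the supremum of the projective dimensions of the finitely generated
right `C`-modules. -/
noncomputable def globalDimension (C : Type u) [Ring C] : WithBot ℕ∞ :=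
  ⨆ (X : ModuleCat.{u} Cᵐᵒᵖ) (_ : Module.Finite Cᵐᵒᵖ X), projectiveDimension X

/-! ## The bimodule `E = Ext²_C(DC, C)` and the relation extension -/

section RelationExtension

variable (k : Type u) [Field k] (C : Type u) [Ring C] [Algebra k C]

/-- `C` as a right `C`-module. -/
abbrev regR : ModuleCat.{u} Cᵐᵒᵖ := ModuleCat.of Cᵐᵒᵖ C

/-- `DC` as a right `C`-module. -/
noncomputable abbrev dualR : ModuleCat.{u} Cᵐᵒᵖ := ModuleCat.of Cᵐᵒᵖ (StdDual k C)

variable {C}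

/-- Left multiplication by `c`, an endomorphism of the right module `C`. -/
def regL (c : C) : regR C ⟶ regR C :=
  ModuleCat.ofHom
    { toFun := fun x => c * x
      map_add' := mul_add c
      map_smul' := fun a x => (mul_assoc c x (unop a)).symm }

/-- The left action of `c` on the bimodule `DC`, `(c f)(x) = f (x c)`, an endomorphism of the
right module `DC`. -/
noncomputable def dualL (c : C) : dualR k C ⟶ dualR k C :=
  ModuleCat.ofHom
    { toFun := fun f => LinearMap.comp (show C →ₗ[k] k from f) (LinearMap.mulRight k c)
      map_add' := fun _ _ => rfl
      map_smul' := fun a f => DFunLike.ext _ _ fun x =>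
        congrArg f (mul_assoc (unop a) x c).symm }

theorem regL_one : regL (1 : C) = 𝟙 _ :=
  ModuleCat.hom_ext (LinearMap.ext fun x : C => one_mul x)

theorem regL_mul (c d : C) : regL (c * d) = regL d ≫ regL c :=
  ModuleCat.hom_ext (LinearMap.ext fun x : C => mul_assoc c d x)

theorem regL_add (c d : C) : regL (c + d) = regL c + regL d :=
  ModuleCat.hom_ext (LinearMap.ext fun x : C => add_mul c d x)

theorem regL_zero : regL (0 : C) = 0 :=
  ModuleCat.hom_ext (LinearMap.ext fun x : C => zero_mul x)

theorem mk₀_regL_smul (r : k) (c : C) :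
    Abelian.Ext.mk₀ (regL (r • c)) = r • Abelian.Ext.mk₀ (regL c) := by
  have h (x : C) : (r • c) * x = (c * x) * algebraMap k C r := by
    rw [smul_mul_assoc, ← Algebra.commutes, Algebra.smul_def]
  rw [← Abelian.Ext.mk₀_smul]
  exact congrArg Abelian.Ext.mk₀ (ModuleCat.hom_ext (LinearMap.ext fun x : C => h x))

theorem dualL_one : dualL k (1 : C) = 𝟙 _ := by
  ext f; exact DFunLike.ext _ _ fun x => congrArg f (mul_one x)

theorem dualL_mul (c d : C) : dualL k (c * d) = dualL k d ≫ dualL k c := by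
  ext f; exact DFunLike.ext _ _ fun x => congrArg f (mul_assoc x c d).symm

theorem dualL_add (c d : C) : dualL k (c + d) = dualL k c + dualL k d := by
  ext f
  exact DFunLike.ext _ _ fun x =>
    (congrArg f (mul_add x c d)).trans (map_add (show C →ₗ[k] k from f) _ _)

theorem dualL_zero : dualL k (0 : C) = 0 := by
  ext f
  exact DFunLike.ext _ _ fun x =>
    (congrArg f (mul_zero x)).trans (map_zero (show C →ₗ[k] k from f))

theorem dualL_smul (r : k) (c : C) : dualL k (r • c) = r • dualL k c := by
  ext f
  refine DFunLike.ext _ _ fun x => ?_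
  change f (x * (r • c)) = f ((algebraMap k C r * x) * c)
  rw [mul_smul_comm, mul_assoc, ← Algebra.smul_def]

variable (C)

/-- `E = Ext²_C(DC, C)`, the Ext group of right `C`-modules. -/
def ExtBimodule : Type u := Abelian.Ext (dualR k C) (regR C) 2

namespace ExtBimodule

noncomputable instance : AddCommGroup (ExtBimodule k C) :=
  inferInstanceAs (AddCommGroup (Abelian.Ext (dualR k C) (regR C) 2))

/-- The canonical `k`-linear structure of the Ext groups. -/
noncomputable instance : Module k (ExtBimodule k C) :=
  inferInstanceAs (Module k (Abelian.Ext (dualR k C) (regR C) 2))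

section Actions

variable {k C}

/-- The left action of `C` on `E`, through the left action of `C` on the second argument `C`. -/
noncomputable def lact (c : C) (e : Abelian.Ext (dualR k C) (regR C) 2) : Abelian.Ext (dualR k C) (regR C) 2 :=
  e.comp (Abelian.Ext.mk₀ (regL c)) (add_zero 2)

/-- The right action of `C` on `E`, through the left action of `C` on the first argument `DC`. -/
noncomputable def ract (c : C) (e : Abelian.Ext (dualR k C) (regR C) 2) : Abelian.Ext (dualR k C) (regR C) 2 :=
  (Abelian.Ext.mk₀ (dualL k c)).comp e (zero_add 2)

theorem lact_one (e : Abelian.Ext (dualR k C) (regR C) 2) : lact 1 e = e := by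
  rw [lact, regL_one, Abelian.Ext.comp_mk₀_id]

theorem lact_mul (c d : C) (e : Abelian.Ext (dualR k C) (regR C) 2) : lact (c * d) e = lact c (lact d e) := by
  simp only [lact]
  rw [regL_mul, Abelian.Ext.comp_assoc_of_third_deg_zero, Abelian.Ext.mk₀_comp_mk₀]

theorem lact_zero (c : C) : lact c (0 : Abelian.Ext (dualR k C) (regR C) 2) = 0 := by
  rw [lact, Abelian.Ext.zero_comp]

theorem lact_add (c : C) (e e' : Abelian.Ext (dualR k C) (regR C) 2) : lact c (e + e') = lact c e + lact c e' := by
  rw [lact, Abelian.Ext.add_comp, lact, lact]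

theorem add_lact (c d : C) (e : Abelian.Ext (dualR k C) (regR C) 2) : lact (c + d) e = lact c e + lact d e := by
  rw [lact, regL_add, Abelian.Ext.mk₀_add, Abelian.Ext.comp_add, lact, lact]

theorem zero_lact (e : Abelian.Ext (dualR k C) (regR C) 2) : lact 0 e = 0 := by
  rw [lact, regL_zero, Abelian.Ext.mk₀_zero, Abelian.Ext.comp_zero]

theorem smul_lact (r : k) (c : C) (e : Abelian.Ext (dualR k C) (regR C) 2) : lact (r • c) e = r • lact c e := by
  rw [lact, mk₀_regL_smul, Abelian.Ext.comp_smul, lact]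

theorem ract_one (e : Abelian.Ext (dualR k C) (regR C) 2) : ract 1 e = e := by
  rw [ract, dualL_one, Abelian.Ext.mk₀_id_comp]

theorem ract_mul (c d : C) (e : Abelian.Ext (dualR k C) (regR C) 2) : ract (c * d) e = ract d (ract c e) := by
  simp only [ract]
  rw [dualL_mul, Abelian.Ext.mk₀_comp_mk₀_assoc]

theorem ract_zero (c : C) : ract c (0 : Abelian.Ext (dualR k C) (regR C) 2) = 0 := by
  rw [ract, Abelian.Ext.comp_zero]

theorem ract_add (c : C) (e e' : Abelian.Ext (dualR k C) (regR C) 2) : ract c (e + e') = ract c e + ract c e' := by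
  rw [ract, Abelian.Ext.comp_add, ract, ract]

theorem add_ract (c d : C) (e : Abelian.Ext (dualR k C) (regR C) 2) : ract (c + d) e = ract c e + ract d e := by
  rw [ract, dualL_add, Abelian.Ext.mk₀_add, Abelian.Ext.add_comp, ract, ract]

theorem zero_ract (e : Abelian.Ext (dualR k C) (regR C) 2) : ract 0 e = 0 := by
  rw [ract, dualL_zero, Abelian.Ext.mk₀_zero, Abelian.Ext.zero_comp]

theorem smul_ract (r : k) (c : C) (e : Abelian.Ext (dualR k C) (regR C) 2) : ract (r • c) e = r • ract c e := by
  rw [ract, dualL_smul, Abelian.Ext.mk₀_smul, Abelian.Ext.smul_comp, ract]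

theorem lact_ract (c d : C) (e : Abelian.Ext (dualR k C) (regR C) 2) : lact c (ract d e) = ract d (lact c e) := by
  simp only [lact, ract]
  rw [Abelian.Ext.comp_assoc_of_third_deg_zero]

end Actions

/-- `c · e` is the composite of `e` with left multiplication by `c` on `C`. -/
noncomputable instance : Module C (ExtBimodule k C) where
  smul c e := lact (k := k) c e
  one_smul e := lact_one e
  mul_smul c d e := lact_mul c d e
  smul_zero c := lact_zero c
  smul_add c e e' := lact_add c e e'
  add_smul c d e := add_lact c d e
  zero_smul e := zero_lact e

/-- `e · c` is the composite of the left action of `c` on `DC` with `e`. -/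
noncomputable instance : Module Cᵐᵒᵖ (ExtBimodule k C) where
  smul c e := ract (k := k) (unop c) e
  one_smul e := ract_one e
  mul_smul c d e := ract_mul (unop d) (unop c) e
  smul_zero c := ract_zero (unop c)
  smul_add c e e' := ract_add (unop c) e e'
  add_smul c d e := add_ract (unop c) (unop d) e
  zero_smul e := zero_ract e

instance : SMulCommClass C Cᵐᵒᵖ (ExtBimodule k C) where
  smul_comm c d e := lact_ract c (unop d) e

instance : IsScalarTower k C (ExtBimodule k C) where
  smul_assoc r c e := smul_lact r c e

instance : IsScalarTower k Cᵐᵒᵖ (ExtBimodule k C) where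
  smul_assoc r c e := smul_ract r (unop c) e

end ExtBimodule

/-- The relation extension `B = C ⋉ E`: the `k`-algebra on `C × E` with multiplication
`(c, e)(c', e') = (c c', c e' + e c')`. -/
abbrev RelationExtension : Type u := TrivSqZeroExt C (ExtBimodule k C)

variable {C}

/-- A right `C`-module viewed as a right `B`-module through the projection `B → C`, that is
`m · (c, e) = m · c`. -/
noncomputable abbrev asRelationExtensionModule (M : ModuleCat.{u} Cᵐᵒᵖ) :
    ModuleCat.{u} (RelationExtension k C)ᵐᵒᵖ :=
  (ModuleCat.restrictScalars
    (TrivSqZeroExt.fstHom k C (ExtBimodule k C)).toRingHom.op).obj M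

end RelationExtension

end RelExt

namespace RelExt

section TauRigid

/-- The map of right modules `Λ → M`, `a ↦ m a`. -/
def orbitMap {Λ : Type u} [Ring Λ] {M : Type u} [AddCommGroup M] [Module Λᵐᵒᵖ M] (m : M) :
    Λ →ₗ[Λᵐᵒᵖ] M where
  toFun a := op a • m
  map_add' a b := add_smul (op a) (op b) m
  map_smul' a b := by
    change op (b * unop a) • m = a • op b • m
    rw [op_mul, op_unop, mul_smul]

theorem orbitMap_apply {Λ : Type u} [Ring Λ] {M : Type u} [AddCommGroup M] [Module Λᵐᵒᵖ M]
    (m : M) (a : Λ) : orbitMap m a = op a • m := rfl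

theorem exists_dual_basis (Λ : Type u) [Ring Λ] (P : Type u) [AddCommGroup P] [Module Λᵐᵒᵖ P]
    [Module.Finite Λᵐᵒᵖ P] [Module.Projective Λᵐᵒᵖ P] :
    ∃ (n : ℕ) (x : Fin n → P) (φ : Fin n → P →ₗ[Λᵐᵒᵖ] Λ), ∀ z, ∑ i, op (φ i z) • x i = z := by
  obtain ⟨n, f, g, -, -, h⟩ := Module.Finite.exists_comp_eq_id_of_projective Λᵐᵒᵖ P
  let e : Λᵐᵒᵖ →ₗ[Λᵐᵒᵖ] Λ :=
    { toFun := unop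
      map_add' := fun _ _ => rfl
      map_smul' := fun _ _ => rfl }
  refine ⟨n, fun i => f (Pi.single i 1), fun i => e ∘ₗ LinearMap.proj i ∘ₗ g, fun z => ?_⟩
  have hz : f (g z) = z := LinearMap.congr_fun h z
  conv_rhs => rw [← hz, pi_eq_sum_univ' (g z), map_sum]
  refine Finset.sum_congr rfl fun i _ => ?_
  rw [← map_smul]
  congr 1

variable {k : Type u} [Field k] {Λ : Type u} [Ring Λ] [Algebra k Λ] {M : ModuleCat.{u} Λᵐᵒᵖ}

open scoped ModuleCat in
/-- The map `M → D Tr M` attached to a linear form on `Hom(P₁, M)` which vanishes on the maps that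
factor through `P₁ → P₀`. -/
noncomputable def MinProjPres.toTau (p : MinProjPres Λ M) (l : (p.P₁ →ₗ[Λᵐᵒᵖ] M) →ₗ[k] k)
    (hl : ∀ h : p.P₀ →ₗ[Λᵐᵒᵖ] M, l (h ∘ₗ p.d₁) = 0) : M →ₗ[Λᵐᵒᵖ] p.tau k where
  toFun m := show p.Transpose →ₗ[k] k from
    (((LinearMap.range p.d₁Star).restrictScalars k).liftQ
      { toFun := fun φ => l (orbitMap m ∘ₗ φ)
        map_add' := fun φ ψ => by rw [LinearMap.comp_add, map_add]
        map_smul' := fun r φ => by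
          rw [RingHom.id_apply, ← map_smul]
          congr 1
          ext x
          change op (r • φ x) • m = r • op (φ x) • m
          rw [op_smul, smul_assoc] }
      (by
        rintro _ ⟨φ, rfl⟩
        exact hl (orbitMap m ∘ₗ φ))) ∘ₗ
      (Submodule.Quotient.restrictScalarsEquiv k (LinearMap.range p.d₁Star)).symm.toLinearMap
  map_add' m m' := by
    refine DFunLike.ext _ _ fun t => ?_
    obtain ⟨φ, rfl⟩ := Submodule.Quotient.mk_surjective _ t
    change l (orbitMap (m + m') ∘ₗ φ) = l (orbitMap m ∘ₗ φ) + l (orbitMap m' ∘ₗ φ)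
    rw [← map_add]
    congr 1
    ext x
    exact smul_add _ _ _
  map_smul' a m := by
    refine DFunLike.ext _ _ fun t => ?_
    obtain ⟨φ, rfl⟩ := Submodule.Quotient.mk_surjective _ t
    change l (orbitMap (a • m) ∘ₗ φ) = l (orbitMap m ∘ₗ (unop a • φ))
    congr 1
    ext x
    change op (φ x) • a • m = op (unop a * φ x) • m
    rw [op_mul, mul_smul, op_unop]

open scoped ModuleCat in
theorem MinProjPres.toTau_apply (p : MinProjPres Λ M) (l : (p.P₁ →ₗ[Λᵐᵒᵖ] M) →ₗ[k] k)
    (hl : ∀ h : p.P₀ →ₗ[Λᵐᵒᵖ] M, l (h ∘ₗ p.d₁) = 0) (m : M) (φ : p.P₁ →ₗ[Λᵐᵒᵖ] Λ) :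
    p.toTau l hl m (Submodule.Quotient.mk φ) = l (orbitMap m ∘ₗ φ) := rfl

open scoped ModuleCat in
theorem MinProjPres.factors_of_hom_tau_eq_zero (p : MinProjPres Λ M)
    (hp : ∀ f : M ⟶ p.tau k, f = 0) (g : p.P₁ →ₗ[Λᵐᵒᵖ] M) :
    ∃ h : p.P₀ →ₗ[Λᵐᵒᵖ] M, h ∘ₗ p.d₁ = g := by
  let W : Submodule k (p.P₁ →ₗ[Λᵐᵒᵖ] M) := LinearMap.range
    ({ toFun := fun h => h ∘ₗ p.d₁
       map_add' := fun _ _ => rfl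
       map_smul' := fun _ _ => rfl } : (p.P₀ →ₗ[Λᵐᵒᵖ] M) →ₗ[k] (p.P₁ →ₗ[Λᵐᵒᵖ] M))
  suffices hW : W = ⊤ by
    have : g ∈ W := hW ▸ Submodule.mem_top
    exact this
  by_contra hW
  obtain ⟨l, hl0, hlW⟩ := W.exists_le_ker_of_lt_top (lt_top_iff_ne_top.2 hW)
  apply hl0
  have hl : ∀ h : p.P₀ →ₗ[Λᵐᵒᵖ] M, l (h ∘ₗ p.d₁) = 0 := fun h => hlW ⟨h, rfl⟩
  have hf : ∀ (m : M) (φ : p.P₁ →ₗ[Λᵐᵒᵖ] Λ), l (orbitMap m ∘ₗ φ) = 0 := fun m φ => by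
    rw [← p.toTau_apply l hl m φ]
    have h0 := congrArg ModuleCat.Hom.hom (hp (ModuleCat.ofHom (p.toTau l hl)))
    exact DFunLike.congr_fun (F := p.tau k) (LinearMap.congr_fun h0 m) (Submodule.Quotient.mk φ)
  have := p.cover₁.finite
  have := p.cover₁.projective
  obtain ⟨n, x, φ, hx⟩ := exists_dual_basis Λ p.P₁
  ext g
  have hg : g = ∑ i, orbitMap (g (x i)) ∘ₗ φ i := by
    ext z
    conv_lhs => rw [← hx z]
    simp [orbitMap_apply]
  rw [hg, map_sum]
  simp [hf]

theorem MinProjPres.hom_tau_eq_zero_of_factors (p : MinProjPres Λ M)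
    (hp : ∀ g : p.P₁ →ₗ[Λᵐᵒᵖ] M, ∃ h : p.P₀ →ₗ[Λᵐᵒᵖ] M, h ∘ₗ p.d₁ = g) (f : M ⟶ p.tau k) :
    f = 0 := by
  have := p.cover₁.finite
  have := p.cover₁.projective
  have := p.cover₀.finite
  have := p.cover₀.projective
  obtain ⟨n, x, φ, hx⟩ := exists_dual_basis Λ p.P₁
  obtain ⟨n', y, ψ, hy⟩ := exists_dual_basis Λ p.P₀
  let F : M → (p.Transpose →ₗ[k] k) := f.hom
  let β : M → (p.P₁ →ₗ[Λᵐᵒᵖ] Λ) → k := fun m χ => F m (Submodule.Quotient.mk χ)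
  have β_smul (m : M) (a : Λ) (χ) : β (op a • m) χ = β m (a • χ) := by
    change (f.hom (op a • m)) _ = _
    rw [map_smul]; rfl
  have β_suml {ι : Type} (s : Finset ι) (v : ι → M) (χ) :
      β (∑ i ∈ s, v i) χ = ∑ i ∈ s, β (v i) χ := by
    have : F (∑ i ∈ s, v i) = ∑ i ∈ s, F (v i) := map_sum f.hom v s
    simp only [β, this, LinearMap.sum_apply]
  have β_sumr {ι : Type} (s : Finset ι) (m) (v : ι → (p.P₁ →ₗ[Λᵐᵒᵖ] Λ)) :
      β m (∑ i ∈ s, v i) = ∑ i ∈ s, β m (v i) := by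
    simp only [β, ← Submodule.mkQ_apply, map_sum]
  have β_range (m : M) (χ : p.P₀ →ₗ[Λᵐᵒᵖ] Λ) : β m (χ ∘ₗ p.d₁) = 0 := by
    have : (Submodule.Quotient.mk (χ ∘ₗ p.d₁) : p.Transpose) = 0 :=
      (Submodule.Quotient.mk_eq_zero _).2 ⟨χ, rfl⟩
    simp only [β, this, map_zero]
  ext m
  refine DFunLike.ext _ _ fun t => ?_
  obtain ⟨χ, rfl⟩ := Submodule.Quotient.mk_surjective _ t
  change β m χ = 0
  obtain ⟨h, hh⟩ := hp (orbitMap m ∘ₗ χ)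
  have expand (χ : p.P₁ →ₗ[Λᵐᵒᵖ] Λ) : ∑ i, χ (x i) • φ i = χ := by
    ext z
    conv_rhs => rw [← hx z, map_sum]
    simp [LinearMap.sum_apply]
  have key : ∑ i, β (h (p.d₁ (x i))) (φ i) = 0 := by
    have : ∀ i, β (h (p.d₁ (x i))) (φ i) =
        ∑ j, β (h (y j)) ((ψ j ∘ₗ p.d₁) (x i) • φ i) := fun i => by
      conv_lhs => rw [← hy (p.d₁ (x i)), map_sum, β_suml]
      refine Finset.sum_congr rfl fun j _ => ?_
      rw [map_smul, β_smul]; rfl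
    rw [Finset.sum_congr rfl fun i _ => this i, Finset.sum_comm]
    refine Finset.sum_eq_zero fun j _ => ?_
    rw [← β_sumr, expand, β_range]
  calc β m χ = ∑ i, β m (χ (x i) • φ i) := by rw [← β_sumr, expand]
    _ = ∑ i, β (h (p.d₁ (x i))) (φ i) := Finset.sum_congr rfl fun i _ => by
      rw [← β_smul]
      exact congrArg (β · (φ i)) (LinearMap.congr_fun hh (x i)).symm
    _ = 0 := key

end TauRigid

section ExtTwo

open Abelian

theorem hasProjectiveDimensionLT_three {C : Type u} [Ring C] (hC : globalDimension C = 2)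
    (X : ModuleCat.{u} Cᵐᵒᵖ) [hX : Module.Finite Cᵐᵒᵖ X] : HasProjectiveDimensionLT X 3 := by
  refine (projectiveDimension_le_iff X 2).1 ?_
  have h : projectiveDimension X ≤ globalDimension C :=
    le_iSup₂_of_le (f := fun (X : ModuleCat.{u} Cᵐᵒᵖ) (_ : Module.Finite Cᵐᵒᵖ X) =>
      projectiveDimension X) X hX le_rfl
  rwa [hC] at h

variable {R : Type u} [Ring R]

theorem ext_two_comp_surjective {D X Y : ModuleCat.{u} R} [HasProjectiveDimensionLT D 3]
    (g : X ⟶ Y) (hg : Function.Surjective g.hom) (y : Ext D Y 2) :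
    ∃ x : Ext D X 2, x.comp (Ext.mk₀ g) (add_zero 2) = y :=
  Ext.covariant_sequence_exact₃ D (LinearMap.shortExact_shortComplexKer hg) y rfl
    (Ext.eq_zero_of_hasProjectiveDimensionLT _ 3 le_rfl)

theorem ext_two_comp_exact {D X Y Z : ModuleCat.{u} R} [HasProjectiveDimensionLT D 3]
    (f : X ⟶ Y) (g : Y ⟶ Z) (hg : Function.Surjective g.hom)
    (hfg : LinearMap.range f.hom = LinearMap.ker g.hom) (y : Ext D Y 2)
    (hy : y.comp (Ext.mk₀ g) (add_zero 2) = 0) :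
    ∃ x : Ext D X 2, x.comp (Ext.mk₀ f) (add_zero 2) = y := by
  obtain ⟨w, hw⟩ := Ext.covariant_sequence_exact₂ D (LinearMap.shortExact_shortComplexKer hg) y hy
  let f' : X ⟶ ModuleCat.of R (LinearMap.ker g.hom) :=
    ModuleCat.ofHom (f.hom.codRestrict _ fun x => hfg ▸ ⟨x, rfl⟩)
  have hf' : Function.Surjective f'.hom := by
    rintro ⟨z, hz⟩
    rw [← hfg] at hz
    obtain ⟨x, rfl⟩ := hz
    exact ⟨x, rfl⟩
  obtain ⟨x, rfl⟩ := ext_two_comp_surjective f' hf' w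
  refine ⟨x, ?_⟩
  rw [← hw, Ext.comp_assoc_of_third_deg_zero, Ext.mk₀_comp_mk₀]
  rfl

theorem ext_eq_sum_comp_orbitMap {C : Type u} [Ring C] {D X : ModuleCat.{u} Cᵐᵒᵖ}
    [HasProjectiveDimensionLT D 3] [Module.Finite Cᵐᵒᵖ X] (y : Ext D X 2) :
    ∃ (n : ℕ) (x : Fin n → X) (e : Fin n → Ext D (regR C) 2),
      y = ∑ i, (e i).comp (Ext.mk₀ (ModuleCat.ofHom (orbitMap (x i)))) (add_zero 2) := by
  obtain ⟨n, f, hf⟩ := Module.Finite.exists_fin' Cᵐᵒᵖ X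
  obtain ⟨w, rfl⟩ := ext_two_comp_surjective (D := D) (ModuleCat.ofHom f) hf y
  let π (i : Fin n) : ModuleCat.of Cᵐᵒᵖ (Fin n → Cᵐᵒᵖ) ⟶ regR C := ModuleCat.ofHom
    { toFun := fun v => unop (v i)
      map_add' := fun _ _ => rfl
      map_smul' := fun _ _ => rfl }
  refine ⟨n, fun i => f (Pi.single i 1), fun i => w.comp (Ext.mk₀ (π i)) (add_zero 2), ?_⟩
  have h : ModuleCat.ofHom f =
      ∑ i, π i ≫ ModuleCat.ofHom (orbitMap (f (Pi.single i (1 : Cᵐᵒᵖ)))) := by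
    refine ModuleCat.hom_ext (LinearMap.ext fun v => ?_)
    rw [ModuleCat.hom_sum, LinearMap.sum_apply]
    change f v = ∑ i, v i • f (Pi.single i (1 : Cᵐᵒᵖ))
    conv_lhs => rw [pi_eq_sum_univ' v, map_sum]
    exact Finset.sum_congr rfl fun i _ => map_smul f _ _
  rw [h, Ext.mk₀_sum, Ext.comp_sum]
  refine Finset.sum_congr rfl fun i _ => ?_
  rw [Ext.comp_assoc_of_third_deg_zero, Ext.mk₀_comp_mk₀]

section Finite

variable (k : Type u) [Field k] (C : Type u) [Ring C] [Algebra k C] [FiniteDimensional k C]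

instance : Module.Finite k (StdDual k C) := inferInstanceAs (Module.Finite k (C →ₗ[k] k))

instance : Module.Finite Cᵐᵒᵖ (StdDual k C) := by
  have : IsScalarTower k Cᵐᵒᵖ (StdDual k C) := ⟨fun r a f => DFunLike.ext _ _ fun x => by
    change f (unop (r • a) * x) = r • f (unop a * x)
    rw [unop_smul, smul_mul_assoc]
    exact map_smul (show C →ₗ[k] k from f) _ _⟩
  exact Module.Finite.of_restrictScalars_finite k Cᵐᵒᵖ _

open scoped ModuleCat in
/-- The map of right modules `X → DC` attached to a linear form on `X`. -/
noncomputable def toDual {X : ModuleCat.{u} Cᵐᵒᵖ} (l : X →ₗ[k] k) : X →ₗ[Cᵐᵒᵖ] StdDual k C where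
  toFun x := show C →ₗ[k] k from
    { toFun := fun c => l (op c • x)
      map_add' := fun a b => (congrArg l (add_smul (op a) (op b) x)).trans (map_add l _ _)
      map_smul' := fun r a => by rw [op_smul, smul_assoc, map_smul]; rfl }
  map_add' x y := DFunLike.ext _ _ fun c => by
    change l (op c • (x + y)) = l (op c • x) + l (op c • y)
    rw [smul_add, map_add]
  map_smul' a x := DFunLike.ext _ _ fun c => by
    change l (op c • a • x) = l (op (unop a * c) • x)
    rw [op_mul, mul_smul, op_unop]

open scoped ModuleCat in
theorem exists_injective_to_dual (X : ModuleCat.{u} Cᵐᵒᵖ) [Module.Finite Cᵐᵒᵖ X] :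
    ∃ (n : ℕ) (f : X →ₗ[Cᵐᵒᵖ] (Fin n → StdDual k C)), Function.Injective f := by
  have : Module.Finite k X := Module.Finite.trans Cᵐᵒᵖ X
  let b := Module.finBasis k X
  refine ⟨_, LinearMap.pi fun i => toDual k C (b.coord i), ?_⟩
  rw [injective_iff_map_eq_zero]
  intro x hx
  refine b.ext_elem fun i => ?_
  have h : b.coord i (op (1 : C) • x) = 0 := DFunLike.congr_fun (congrFun hx i) (1 : C)
  rw [op_one, one_smul] at h
  simpa using h

variable {C}

theorem ext_two_eq_zero_of_dual (hC : globalDimension C = 2) {M : ModuleCat.{u} Cᵐᵒᵖ}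
    (hM : ∀ y : Ext (dualR k C) M 2, y = 0) (X : ModuleCat.{u} Cᵐᵒᵖ) [Module.Finite Cᵐᵒᵖ X]
    (y : Ext X M 2) : y = 0 := by
  obtain ⟨n, f, hf⟩ := exists_injective_to_dual k C X
  let Y := ModuleCat.of Cᵐᵒᵖ (Fin n → StdDual k C)
  have hY (y : Ext Y M 2) : y = 0 := by
    have h : 𝟙 Y = ∑ i, ModuleCat.ofHom (LinearMap.proj i : _ →ₗ[Cᵐᵒᵖ] StdDual k C) ≫
        ModuleCat.ofHom (LinearMap.single Cᵐᵒᵖ (fun _ : Fin n => StdDual k C) i) := by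
      refine ModuleCat.hom_ext (LinearMap.ext fun v => ?_)
      rw [ModuleCat.hom_sum, LinearMap.sum_apply]
      exact (Finset.univ_sum_single v).symm
    rw [← Ext.mk₀_id_comp y, h, Ext.mk₀_sum, Ext.sum_comp]
    refine Finset.sum_eq_zero fun i _ => ?_
    rw [← Ext.mk₀_comp_mk₀_assoc, hM (Ext.comp _ _ _), Ext.comp_zero]
  have := hasProjectiveDimensionLT_three hC
    (ModuleCat.of Cᵐᵒᵖ ((Fin n → StdDual k C) ⧸ LinearMap.range f))
  have hS := ModuleCat.shortComplex_shortExact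
    (ModuleCat.shortComplexOfCompEqZero _ _ f.exact_map_mkQ_range.linearMap_comp_eq_zero)
      f.exact_map_mkQ_range hf (Submodule.mkQ_surjective _)
  obtain ⟨w, rfl⟩ := Ext.contravariant_sequence_exact₁ hS M y (n₁ := 3) rfl
    (Ext.eq_zero_of_hasProjectiveDimensionLT (X := ModuleCat.of Cᵐᵒᵖ
      ((Fin n → StdDual k C) ⧸ LinearMap.range f)) _ 3 le_rfl)
  rw [hY w, Ext.comp_zero]

end Finite

theorem injective_of_ext_one {N : ModuleCat.{u} R}
    (hN : ∀ (X : ModuleCat.{u} R) [Module.Finite R X] (y : Ext X N 1), y = 0) : Injective N := by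
  refine (Module.injective_iff_injective_object R N).1 (Module.Baer.injective fun I g => ?_)
  have hS := ModuleCat.shortComplex_shortExact
    (ModuleCat.shortComplexOfCompEqZero I.subtype I.mkQ
      (LinearMap.exact_subtype_mkQ I).linearMap_comp_eq_zero)
      (LinearMap.exact_subtype_mkQ I) I.injective_subtype (Submodule.mkQ_surjective _)
  obtain ⟨w, hw⟩ := Ext.contravariant_sequence_exact₁ hS N
    (Ext.mk₀ (ModuleCat.ofHom g)) (n₁ := 1) rfl (hN (ModuleCat.of R (R ⧸ I)) _)
  obtain ⟨w, rfl⟩ := (Ext.mk₀_bijective _ _).2 w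
  rw [Ext.mk₀_comp_mk₀] at hw
  have h := (Ext.mk₀_bijective _ _).1 hw
  exact ⟨w.hom, fun x hx => LinearMap.congr_fun (congrArg ModuleCat.Hom.hom h) ⟨x, hx⟩⟩

theorem injectiveDimension_le_one_of_ext_two {M : ModuleCat.{u} R}
    (hM : ∀ (X : ModuleCat.{u} R) [Module.Finite R X] (y : Ext X M 2), y = 0) :
    injectiveDimension M ≤ 1 := by
  let ⟨I, _, f, _⟩ := EnoughInjectives.presentation M
  have hf : Function.Injective f.hom := (ModuleCat.mono_iff_injective f).mp ‹_›
  have hS := ModuleCat.shortComplex_shortExact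
    (ModuleCat.shortComplexOfCompEqZero _ _ f.hom.exact_map_mkQ_range.linearMap_comp_eq_zero)
      f.hom.exact_map_mkQ_range hf (Submodule.mkQ_surjective _)
  refine (injectiveDimension_le_iff M 1).2 ((hS.hasInjectiveDimensionLT_X₃_iff 0 ‹_›).1 ?_)
  refine injective_iff_hasInjectiveDimensionLT_one.1 (injective_of_ext_one fun X _ y => ?_)
  obtain ⟨w, rfl⟩ := Ext.covariant_sequence_exact₃ X hS y rfl (hM X _)
  rw [Ext.eq_zero_of_injective w, Ext.zero_comp]

theorem injectiveDimension_le_one_iff_ext_dual (k : Type u) [Field k] {C : Type u} [Ring C]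
    [Algebra k C] [FiniteDimensional k C] (hC : globalDimension C = 2) (M : ModuleCat.{u} Cᵐᵒᵖ) :
    injectiveDimension M ≤ 1 ↔ ∀ y : Ext (dualR k C) M 2, y = 0 := by
  refine ⟨fun h y => ?_, fun h =>
    injectiveDimension_le_one_of_ext_two fun X _ y => ext_two_eq_zero_of_dual k hC h X y⟩
  have : HasInjectiveDimensionLT M 2 := (injectiveDimension_le_iff M 1).1 h
  exact Ext.eq_zero_of_hasInjectiveDimensionLT y 2 le_rfl

end ExtTwo

section Induced

open Abelian

variable (k : Type u) [Field k] {C : Type u} [Ring C] [Algebra k C]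

/-- The right module `X ⊕ Ext²_C(DC, X)` over the relation extension, for a right `C`-module `X`. -/
def Induced (X : ModuleCat.{u} Cᵐᵒᵖ) : Type u := X × Ext (dualR k C) X 2

namespace Induced

variable (X : ModuleCat.{u} Cᵐᵒᵖ)

noncomputable instance : AddCommGroup (Induced k X) :=
  inferInstanceAs (AddCommGroup (X × Ext (dualR k C) X 2))

variable {k X}

/-- The element `(x, y)` of `X ⊕ Ext²(DC, X)`. -/
def mk (x : X) (y : Ext (dualR k C) X 2) : Induced k X := (x, y)

/-- The first component of an element of `X ⊕ Ext²(DC, X)`. -/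
noncomputable def fst : Induced k X →+ X := AddMonoidHom.fst X (Ext (dualR k C) X 2)

/-- The second component of an element of `X ⊕ Ext²(DC, X)`. -/
noncomputable def snd : Induced k X →+ Ext (dualR k C) X 2 :=
  AddMonoidHom.snd X (Ext (dualR k C) X 2)

@[simp] theorem fst_mk (x : X) (y : Ext (dualR k C) X 2) : fst (mk x y) = x := rfl

@[simp] theorem snd_mk (x : X) (y : Ext (dualR k C) X 2) : snd (mk x y) = y := rfl

theorem ext' {z w : Induced k X} (h₁ : fst z = fst w) (h₂ : snd z = snd w) : z = w :=
  Prod.ext h₁ h₂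

theorem mk_add_zero (x y : X) : mk (k := k) (x + y) 0 = mk x 0 + mk y 0 :=
  ext' rfl (add_zero 0).symm

/-- An element of the bimodule `E`, as an extension class. -/
noncomputable def toExt : ExtBimodule k C →+ Ext (dualR k C) (regR C) 2 := AddMonoidHom.id _

theorem toExt_surjective : Function.Surjective (toExt : ExtBimodule k C →+ _) := fun e => ⟨e, rfl⟩

theorem toExt_smul (c : C) (e : ExtBimodule k C) :
    toExt (c • e) = ExtBimodule.lact c (toExt e) := rfl

theorem toExt_op_smul (c : C) (e : ExtBimodule k C) :
    toExt (op c • e) = ExtBimodule.ract c (toExt e) := rfl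

/-- The composite of `e ∈ Ext²(DC, C)` with the map `C → X`, `1 ↦ x`. -/
noncomputable def pair (x : X) (e : ExtBimodule k C) : Ext (dualR k C) X 2 :=
  (toExt e).comp (Ext.mk₀ (ModuleCat.ofHom (orbitMap x))) (add_zero 2)

/-- The right action of `C` on `Ext²(DC, X)`. -/
noncomputable def act (c : C) (y : Ext (dualR k C) X 2) : Ext (dualR k C) X 2 :=
  (Ext.mk₀ (dualL k c)).comp y (zero_add 2)

theorem pair_add (x : X) (e e' : ExtBimodule k C) :
    pair x (e + e') = pair x e + pair x e' := by
  simp [pair, Ext.add_comp]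

theorem add_pair (x x' : X) (e : ExtBimodule k C) :
    pair (x + x') e = pair x e + pair x' e := by
  have : orbitMap (Λ := C) (x + x') = orbitMap x + orbitMap x' :=
    LinearMap.ext fun c => smul_add (op c) x x'
  rw [pair, this, ModuleCat.ofHom_add, Ext.mk₀_add, Ext.comp_add, pair, pair]

theorem pair_zero (x : X) : pair x (0 : ExtBimodule k C) = 0 := by
  rw [pair, map_zero, Ext.zero_comp]

theorem zero_pair (e : ExtBimodule k C) : pair (0 : X) e = 0 := by
  have : orbitMap (Λ := C) (0 : X) = 0 := LinearMap.ext fun c => smul_zero (op c)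
  rw [pair, this, ModuleCat.ofHom_zero, Ext.mk₀_zero, Ext.comp_zero]

theorem smul_pair (c : C) (x : X) (e : ExtBimodule k C) :
    pair (op c • x) e = pair x (c • e) := by
  have : ModuleCat.ofHom (orbitMap (op c • x)) = regL c ≫ ModuleCat.ofHom (orbitMap x) :=
    ModuleCat.hom_ext (LinearMap.ext fun a : C => by
      change op a • op c • x = op (c * a) • x
      rw [op_mul, mul_smul])
  rw [pair, pair, toExt_smul, ExtBimodule.lact, Ext.comp_assoc_of_third_deg_zero,
    Ext.mk₀_comp_mk₀, this]

theorem act_pair (c : C) (x : X) (e : ExtBimodule k C) :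
    act c (pair x e) = pair x (op c • e) := by
  rw [act, pair, pair, toExt_op_smul, ExtBimodule.ract, Ext.comp_assoc_of_third_deg_zero]

theorem act_one (y : Ext (dualR k C) X 2) : act 1 y = y := by
  rw [act, dualL_one, Ext.mk₀_id_comp]

theorem act_mul (c d : C) (y : Ext (dualR k C) X 2) : act (c * d) y = act d (act c y) := by
  rw [act, act, act, dualL_mul, Ext.mk₀_comp_mk₀_assoc]

theorem act_add (c : C) (y y' : Ext (dualR k C) X 2) : act c (y + y') = act c y + act c y' :=
  Ext.comp_add _ _ _ _

theorem add_act (c d : C) (y : Ext (dualR k C) X 2) : act (c + d) y = act c y + act d y := by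
  rw [act, dualL_add, Ext.mk₀_add, Ext.add_comp, act, act]

theorem act_zero (c : C) : act c (0 : Ext (dualR k C) X 2) = 0 := Ext.comp_zero _ _ _ _ _

theorem zero_act (y : Ext (dualR k C) X 2) : act 0 y = 0 := by
  rw [act, dualL_zero, Ext.mk₀_zero, Ext.zero_comp]

theorem act_comp {Y : ModuleCat.{u} Cᵐᵒᵖ} (f : X ⟶ Y) (c : C) (y : Ext (dualR k C) X 2) :
    (act c y).comp (Ext.mk₀ f) (add_zero 2) = act c (y.comp (Ext.mk₀ f) (add_zero 2)) := by
  rw [act, act, Ext.comp_assoc_of_third_deg_zero]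

theorem pair_comp {Y : ModuleCat.{u} Cᵐᵒᵖ} (f : X ⟶ Y) (x : X) (e : ExtBimodule k C) :
    (pair x e).comp (Ext.mk₀ f) (add_zero 2) = pair (f.hom x) e := by
  rw [pair, pair, Ext.comp_assoc_of_third_deg_zero, Ext.mk₀_comp_mk₀]
  have : ModuleCat.ofHom (orbitMap x) ≫ f = ModuleCat.ofHom (orbitMap (Λ := C) (f.hom x)) :=
    ModuleCat.hom_ext (LinearMap.ext fun c => map_smul f.hom (op c) x)
  rw [this]

noncomputable instance : SMul (RelationExtension k C)ᵐᵒᵖ (Induced k X) where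
  smul b z := mk (op (unop b).fst • fst z) (act (unop b).fst (snd z) + pair (fst z) (unop b).snd)

theorem fst_smul (b : (RelationExtension k C)ᵐᵒᵖ) (z : Induced k X) :
    fst (b • z) = op (unop b).fst • fst z := rfl

theorem snd_smul (b : (RelationExtension k C)ᵐᵒᵖ) (z : Induced k X) :
    snd (b • z) = act (unop b).fst (snd z) + pair (fst z) (unop b).snd := rfl

noncomputable instance : Module (RelationExtension k C)ᵐᵒᵖ (Induced k X) where
  one_smul z := ext' (by simp [fst_smul]) (by simp [snd_smul, act_one, pair_zero])
  mul_smul b b' z := ext' (by simp [fst_smul, mul_smul]) (by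
    simp only [snd_smul, fst_smul, unop_mul, TrivSqZeroExt.fst_mul, TrivSqZeroExt.snd_mul,
      act_mul, act_add, act_pair, smul_pair, pair_add]
    abel)
  smul_zero b := ext' (by simp [fst_smul]) (by simp [snd_smul, act_zero, zero_pair])
  smul_add b z z' := ext' (by simp [fst_smul]) (by
    simp only [snd_smul, map_add, act_add, add_pair]
    abel)
  add_smul b b' z := ext' (by simp [fst_smul, add_smul]) (by
    rw [map_add, snd_smul, snd_smul, snd_smul, MulOpposite.unop_add, TrivSqZeroExt.fst_add,
      TrivSqZeroExt.snd_add, add_act, pair_add]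
    abel)
  zero_smul z := ext' (by simp [fst_smul]) (by simp [snd_smul, zero_act, pair_zero])

/-- The map of `B`-modules induced by a map of `C`-modules. -/
noncomputable def map {X Y : ModuleCat.{u} Cᵐᵒᵖ} (f : X ⟶ Y) :
    Induced k X →ₗ[(RelationExtension k C)ᵐᵒᵖ] Induced k Y where
  toFun z := mk (f.hom (fst z)) ((snd z).comp (Ext.mk₀ f) (add_zero 2))
  map_add' z z' := ext' (by simp) (by simp [Ext.add_comp])
  map_smul' b z := ext' (by simp [fst_smul])
    (by simp [snd_smul, Ext.add_comp, act_comp, pair_comp])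

variable (k X) in
/-- The projection `X ⊕ Ext²(DC, X) → X`, as a map of `B`-modules. -/
noncomputable def proj : Induced k X →ₗ[(RelationExtension k C)ᵐᵒᵖ]
    asRelationExtensionModule k X where
  toFun z := (fst z : X)
  map_add' z w := map_add (fst : Induced k X →+ X) z w
  map_smul' b z := fst_smul b z

variable (k) in
/-- A map of `C`-modules, as a map of `B`-modules. -/
noncomputable def restrict {X Y : ModuleCat.{u} Cᵐᵒᵖ} (f : X →ₗ[Cᵐᵒᵖ] Y) :
    asRelationExtensionModule k X →ₗ[(RelationExtension k C)ᵐᵒᵖ]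
      asRelationExtensionModule k Y where
  toFun x := f x
  map_add' := map_add f
  map_smul' b x := map_smul f (op (unop b).1) x

theorem smul_inr (z : Induced k X) (e : ExtBimodule k C) :
    op (TrivSqZeroExt.inr e : RelationExtension k C) • z = mk 0 (pair (fst z) e) :=
  ext' (by simp [fst_smul]) (by simp [snd_smul, zero_act])

theorem smul_eq_zero_of_fst_eq_zero {z : Induced k X} (hz : fst z = 0)
    {b : RelationExtension k C} (hb : b.fst = 0) : op b • z = 0 :=
  ext' (by simp [fst_smul, hz]) (by simp [snd_smul, hz, hb, zero_act, zero_pair])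

theorem inl_smul_mk (c : C) (x : X) :
    op (TrivSqZeroExt.inl c : RelationExtension k C) • mk x 0 = mk (k := k) (op c • x) 0 :=
  ext' (by simp [fst_smul]) (by simp [snd_smul, act_zero, pair_zero])

theorem eq_sum_of_fst_eq_zero [HasProjectiveDimensionLT (dualR k C) 3] [Module.Finite Cᵐᵒᵖ X]
    {z : Induced k X} (hz : fst z = 0) :
    ∃ (n : ℕ) (x : Fin n → X) (e : Fin n → ExtBimodule k C),
      z = ∑ i, mk 0 (pair (x i) (e i)) := by
  obtain ⟨n, x, e, h⟩ := ext_eq_sum_comp_orbitMap (snd z)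
  choose e' he' using fun i => toExt_surjective (e i)
  exact ⟨n, x, e', ext' (by simp [hz]) (by simp [h, pair, he'])⟩

theorem mem_of_fst_eq_zero [HasProjectiveDimensionLT (dualR k C) 3] [Module.Finite Cᵐᵒᵖ X]
    {N : Submodule (RelationExtension k C)ᵐᵒᵖ (Induced k X)}
    (hN : ∀ x : X, ∃ z ∈ N, fst z = x) {z : Induced k X} (hz : fst z = 0) : z ∈ N := by
  obtain ⟨n, x, e, rfl⟩ := eq_sum_of_fst_eq_zero hz
  refine Submodule.sum_mem N fun i _ => ?_
  obtain ⟨w, hw, hwx⟩ := hN (x i)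
  rw [← hwx, ← smul_inr]
  exact N.smul_mem _ hw

theorem eq_top_of_fst_surjective [HasProjectiveDimensionLT (dualR k C) 3] [Module.Finite Cᵐᵒᵖ X]
    {N : Submodule (RelationExtension k C)ᵐᵒᵖ (Induced k X)}
    (hN : ∀ x : X, ∃ z ∈ N, fst z = x) : N = ⊤ := by
  refine eq_top_iff.2 fun z _ => ?_
  obtain ⟨w, hw, hwz⟩ := hN (fst z)
  rw [← add_sub_cancel w z]
  exact N.add_mem hw (mem_of_fst_eq_zero hN (by rw [map_sub, hwz, sub_self]))

theorem exists_section (P : ModuleCat.{u} Cᵐᵒᵖ) [Module.Finite Cᵐᵒᵖ P]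
    [Module.Projective Cᵐᵒᵖ P] :
    ∃ (n : ℕ) (f : (Fin n → (RelationExtension k C)ᵐᵒᵖ) →ₗ[(RelationExtension k C)ᵐᵒᵖ] Induced k P)
      (g : Induced k P →ₗ[(RelationExtension k C)ᵐᵒᵖ] (Fin n → (RelationExtension k C)ᵐᵒᵖ)),
      f ∘ₗ g = LinearMap.id := by
  obtain ⟨n, x, φ, h⟩ := exists_dual_basis C P
  let e : Induced k (regR C) →ₗ[(RelationExtension k C)ᵐᵒᵖ] (RelationExtension k C)ᵐᵒᵖ :=
    { toFun := fun z => op (fst z, snd z)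
      map_add' := fun _ _ => rfl
      map_smul' := fun b z => unop_injective (TrivSqZeroExt.ext rfl
        (add_comm (ExtBimodule.ract (unop b).fst (snd z))
          (ExtBimodule.lact (fst z) (unop b).snd))) }
  refine ⟨n, Fintype.linearCombination _ fun i => mk (x i) 0,
    LinearMap.pi fun i => e ∘ₗ map (Y := regR C) (ModuleCat.ofHom (φ i)), ?_⟩
  have hid : 𝟙 P = ∑ i, ModuleCat.ofHom (φ i) ≫ ModuleCat.ofHom (orbitMap (x i)) := by
    refine ModuleCat.hom_ext (LinearMap.ext fun v => ?_)
    rw [ModuleCat.hom_sum, LinearMap.sum_apply]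
    exact (h v).symm
  refine LinearMap.ext fun z => ?_
  rw [LinearMap.comp_apply, Fintype.linearCombination_apply, LinearMap.id_apply]
  refine ext' (by rw [map_sum]; exact h (fst z)) ?_
  rw [map_sum]
  conv_rhs => rw [← Ext.comp_mk₀_id (snd z), hid, Ext.mk₀_sum, Ext.comp_sum]
  refine Finset.sum_congr rfl fun i _ => ?_
  rw [snd_smul, snd_mk, act_zero, zero_add, fst_mk, ← Ext.mk₀_comp_mk₀,
    ← Ext.comp_assoc_of_third_deg_zero]
  rfl

instance {P : ModuleCat.{u} Cᵐᵒᵖ} [Module.Finite Cᵐᵒᵖ P] [Module.Projective Cᵐᵒᵖ P] :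
    Module.Finite (RelationExtension k C)ᵐᵒᵖ (Induced k P) := by
  obtain ⟨n, f, g, h⟩ := exists_section (k := k) P
  exact Module.Finite.of_surjective f fun z => ⟨g z, LinearMap.congr_fun h z⟩

instance {P : ModuleCat.{u} Cᵐᵒᵖ} [Module.Finite Cᵐᵒᵖ P] [Module.Projective Cᵐᵒᵖ P] :
    Module.Projective (RelationExtension k C)ᵐᵒᵖ (Induced k P) := by
  obtain ⟨n, f, g, h⟩ := exists_section (k := k) P
  exact Module.Projective.of_split g f h

end Induced

end Induced

section RelationExtensionRigidity

open Abelian Induced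

variable {k : Type u} [Field k] {C : Type u} [Ring C] [Algebra k C]

theorem pair_eq_zero_of_factors {M : ModuleCat.{u} Cᵐᵒᵖ}
    (hfaithful : ∀ c : C, (∀ m : M, op c • m = 0) → c = 0)
    (p : MinProjPres (RelationExtension k C) (asRelationExtensionModule k M))
    (hp : ∀ g : p.P₁ →ₗ[(RelationExtension k C)ᵐᵒᵖ] asRelationExtensionModule k M,
      ∃ h : p.P₀ →ₗ[(RelationExtension k C)ᵐᵒᵖ] asRelationExtensionModule k M, h ∘ₗ p.d₁ = g)
    (m : M) (e : ExtBimodule k C) : pair m e = 0 := by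
  have := p.cover₁.finite
  have := p.cover₁.projective
  have := p.cover₀.projective
  obtain ⟨φ, hφ⟩ := Module.projective_lifting_property (proj k M) p.d₀
    (fun x => ⟨mk x 0, rfl⟩)
  have hφ' (q : p.P₀) : fst (φ q) = p.d₀ q := LinearMap.congr_fun hφ q
  obtain ⟨q, hq⟩ := p.cover₀.surjective m
  let b : RelationExtension k C := TrivSqZeroExt.inr e
  have hb (v : asRelationExtensionModule k M) : op b • v = 0 := zero_smul Cᵐᵒᵖ (show M from v)
  have hz : op b • q ∈ LinearMap.ker p.d₀ := by
    rw [LinearMap.mem_ker, map_smul, hb]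
  obtain ⟨x, hx⟩ := p.cover₁.surjective ⟨_, hz⟩
  replace hx : p.d₁ x = op b • q := congrArg Subtype.val hx
  have hg (g : p.P₁ →ₗ[(RelationExtension k C)ᵐᵒᵖ] asRelationExtensionModule k M) : g x = 0 := by
    obtain ⟨h, rfl⟩ := hp g
    rw [LinearMap.comp_apply, hx, map_smul, hb]
  obtain ⟨n, v, χ, hv⟩ := exists_dual_basis (RelationExtension k C) p.P₁
  have hχ (i) : (χ i x).fst = 0 := hfaithful _ fun m' =>
    hg (orbitMap (M := asRelationExtensionModule k M) m' ∘ₗ χ i)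
  have h0 : φ (op b • q) = 0 := by
    rw [← hx, ← hv x, map_sum, map_sum]
    refine Finset.sum_eq_zero fun i _ => ?_
    rw [map_smul, map_smul]
    exact smul_eq_zero_of_fst_eq_zero ((hφ' _).trans (p.e₁ (v i)).2) (hχ i)
  rw [map_smul, smul_inr, hφ', hq] at h0
  exact congrArg snd h0

theorem ext_two_eq_zero_of_pair [HasProjectiveDimensionLT (dualR k C) 3] {M : ModuleCat.{u} Cᵐᵒᵖ}
    [Module.Finite Cᵐᵒᵖ M] (h : ∀ (m : M) (e : ExtBimodule k C), pair m e = 0)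
    (y : Ext (dualR k C) M 2) : y = 0 := by
  obtain ⟨n, x, e, hy⟩ := eq_sum_of_fst_eq_zero (z := mk (0 : M) y) rfl
  have := congrArg snd hy
  simpa [h] using this

namespace Induced

/-- The image of a submodule of `X ⊕ Ext²(DC, X)` in `X`. -/
def fstImage {X : ModuleCat.{u} Cᵐᵒᵖ}
    (N : Submodule (RelationExtension k C)ᵐᵒᵖ (Induced k X)) : Submodule Cᵐᵒᵖ X where
  carrier := {x | ∃ z ∈ N, fst z = x}
  add_mem' := by
    rintro _ _ ⟨z, hz, rfl⟩ ⟨w, hw, rfl⟩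
    exact ⟨z + w, N.add_mem hz hw, map_add _ _ _⟩
  zero_mem' := ⟨0, N.zero_mem, rfl⟩
  smul_mem' := by
    rintro c _ ⟨z, hz, rfl⟩
    exact ⟨op (TrivSqZeroExt.inl (unop c)) • z, N.smul_mem _ hz, rfl⟩

theorem superfluous_ker [HasProjectiveDimensionLT (dualR k C) 3] {P X : ModuleCat.{u} Cᵐᵒᵖ}
    {Y : Type u} [AddCommGroup Y] [Module (RelationExtension k C)ᵐᵒᵖ Y] [Module.Finite Cᵐᵒᵖ P]
    {f : P →ₗ[Cᵐᵒᵖ] X} (hf : ∀ N : Submodule Cᵐᵒᵖ P, N ⊔ LinearMap.ker f = ⊤ → N = ⊤)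
    (f' : Induced k P →ₗ[(RelationExtension k C)ᵐᵒᵖ] Y) (hf' : ∀ z, f' z = 0 → f (fst z) = 0)
    (N : Submodule (RelationExtension k C)ᵐᵒᵖ (Induced k P)) (hN : N ⊔ LinearMap.ker f' = ⊤) :
    N = ⊤ := by
  refine eq_top_of_fst_surjective fun x => ?_
  have : fstImage N = ⊤ := by
    refine hf _ (eq_top_iff.2 fun x _ => ?_)
    have hx : mk x 0 ∈ N ⊔ LinearMap.ker f' := hN ▸ Submodule.mem_top
    obtain ⟨z, hz, l, hl, h⟩ := Submodule.mem_sup.1 hx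
    exact Submodule.mem_sup.2 ⟨fst z, ⟨z, hz, rfl⟩, fst l, hf' l hl, by rw [← map_add, h, fst_mk]⟩
  exact this.ge (Submodule.mem_top : x ∈ _)

end Induced

/-- The minimal projective presentation `P₁ ⊗ B → P₀ ⊗ B → M → 0` of `M` over the relation
extension `B`, when `Ext²(DC, M) = 0`. -/
noncomputable def MinProjPres.induced [HasProjectiveDimensionLT (dualR k C) 3]
    {M : ModuleCat.{u} Cᵐᵒᵖ} (p : MinProjPres C M) (hM : ∀ y : Ext (dualR k C) M 2, y = 0) :
    MinProjPres (RelationExtension k C) (asRelationExtensionModule k M) where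
  P₀ := ModuleCat.of _ (Induced k p.P₀)
  P₁ := ModuleCat.of _ (Induced k p.P₁)
  d₀ := restrict k p.d₀ ∘ₗ proj k p.P₀
  e₁ := (map (ModuleCat.ofHom p.d₁)).codRestrict _ fun z => (p.e₁ (fst z)).2
  cover₀ :=
    have := p.cover₀.finite
    have := p.cover₀.projective
    { finite := inferInstanceAs (Module.Finite _ (Induced k p.P₀))
      projective := inferInstanceAs (Module.Projective _ (Induced k p.P₀))
      surjective := fun m => by
        obtain ⟨x, hx⟩ := p.cover₀.surjective m
        exact ⟨Induced.mk x 0, hx⟩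
      superfluous := superfluous_ker p.cover₀.superfluous _ fun _ h => h }
  cover₁ :=
    have := p.cover₁.finite
    have := p.cover₁.projective
    { finite := inferInstanceAs (Module.Finite _ (Induced k p.P₁))
      projective := inferInstanceAs (Module.Projective _ (Induced k p.P₁))
      surjective := by
        rintro ⟨w, hw⟩
        obtain ⟨x, hx⟩ := p.cover₁.surjective ⟨fst w, hw⟩
        have hrange : LinearMap.range p.d₁ = LinearMap.ker p.d₀ := by
          rw [MinProjPres.d₁, LinearMap.range_comp,
            LinearMap.range_eq_top.2 p.cover₁.surjective, Submodule.map_top,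
            Submodule.range_subtype]
        obtain ⟨y, hy⟩ := ext_two_comp_exact (ModuleCat.ofHom p.d₁) (ModuleCat.ofHom p.d₀)
          p.cover₀.surjective hrange (snd w) (hM _)
        exact ⟨Induced.mk x y, Subtype.ext (ext' (congrArg Subtype.val hx) hy)⟩
      superfluous := superfluous_ker (X := ModuleCat.of Cᵐᵒᵖ (LinearMap.ker p.d₀))
        p.cover₁.superfluous _ fun z hz =>
          Subtype.ext (congrArg fst (congrArg Subtype.val hz)) }

theorem MinProjPres.induced_factors [HasProjectiveDimensionLT (dualR k C) 3]
    {M : ModuleCat.{u} Cᵐᵒᵖ} (p : MinProjPres C M) (hM : ∀ y : Ext (dualR k C) M 2, y = 0)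
    (hp : ∀ g : p.P₁ →ₗ[Cᵐᵒᵖ] M, ∃ h : p.P₀ →ₗ[Cᵐᵒᵖ] M, h ∘ₗ p.d₁ = g)
    (g : Induced k p.P₁ →ₗ[(RelationExtension k C)ᵐᵒᵖ] asRelationExtensionModule k M) :
    ∃ h : Induced k p.P₀ →ₗ[(RelationExtension k C)ᵐᵒᵖ] asRelationExtensionModule k M,
      h ∘ₗ (p.induced hM).d₁ = g := by
  have := p.cover₁.finite
  let g₀ : p.P₁ →ₗ[Cᵐᵒᵖ] M :=
    { toFun := fun x => g (Induced.mk x 0)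
      map_add' := fun x y => (congrArg g (mk_add_zero x y)).trans (map_add g _ _)
      map_smul' := fun c x => (congrArg g (inl_smul_mk (unop c) x)).symm.trans (map_smul g _ _) }
  obtain ⟨h, hh⟩ := hp g₀
  refine ⟨restrict k h ∘ₗ proj k p.P₀, LinearMap.ext fun z => ?_⟩
  have hker {w : Induced k p.P₁} (hw : fst w = 0) : g w = 0 := by
    obtain ⟨n, x, e, rfl⟩ := eq_sum_of_fst_eq_zero hw
    rw [map_sum]
    refine Finset.sum_eq_zero fun i _ => ?_
    have := smul_inr (Induced.mk (x i) 0) (e i)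
    rw [fst_mk] at this
    rw [← this, map_smul]
    exact zero_smul Cᵐᵒᵖ (show M from _)
  have hz (z : Induced k p.P₁) : g z = g (Induced.mk (fst z) 0) := by
    rw [← sub_eq_zero, ← map_sub]
    exact hker (by simp)
  exact (LinearMap.congr_fun hh (fst z)).trans (hz z).symm

end RelationExtensionRigidity

end RelExt

theorem proposition3p6 (k : Type u) [Field k] [IsAlgClosed k]
    (C : Type u) [Ring C] [Algebra k C] [FiniteDimensional k C]
    (hC : RelExt.globalDimension C = 2)
    (M : ModuleCat.{u} Cᵐᵒᵖ) [Module.Finite Cᵐᵒᵖ M]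
    (hfaithful : ∀ c : C, (∀ m : M, MulOpposite.op c • m = 0) → c = 0)
    (hrigid : RelExt.IsTauRigid k C M) :
    RelExt.IsTauRigid k (RelExt.RelationExtension k C) (RelExt.asRelationExtensionModule k M) ↔
      injectiveDimension M ≤ 1 := by
  have := RelExt.hasProjectiveDimensionLT_three hC (RelExt.dualR k C)
  rw [RelExt.injectiveDimension_le_one_iff_ext_dual k hC]
  constructor
  · rintro ⟨p, hp⟩
    exact RelExt.ext_two_eq_zero_of_pair
      (RelExt.pair_eq_zero_of_factors hfaithful p (p.factors_of_hom_tau_eq_zero hp))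
  · intro hM
    obtain ⟨p, hp⟩ := hrigid
    exact ⟨p.induced hM, (p.induced hM).hom_tau_eq_zero_of_factors
      (p.induced_factors hM (p.factors_of_hom_tau_eq_zero hp))⟩
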